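/- Let $\alpha\in\mathbb R$, let $K_1,K_2\in C([0,1])$ satisfy $K_1(x)<0<K_2(x)$ for all $x\in[0,1]$ and have second distributional derivatives in $L^2([0,1])$, and let $f,\sigma:[0,1]\times\mathbb R\to\mathbb R$ be bounded (with $f$ measurable in $x$) such that, for some $C,m>0$ and all $x\in[0,1]$, $y,\hat y\in\mathbb R$, $$|f(x,y)-f(x,\hat y)|+|\sigma(x,y)-\sigma(x,\hat y)|\le C|y-\hat y|,\qquad |\sigma(x,y)|\ge m,\qquad f(x,0)=0,$$ and $\sigma$ is jointly continuous. Put $E=\{z\in C([0,1]): K_1\le z\le K_2\}$ with the maximum norm. Let $T=[t_1,t_2]$ with $-\infty<t_1<t_2$, or $T=(-\infty,t_2]$, in which case $t_1=-\infty$. For $\dot h:[0,1]\times T\to\mathbb R$ that is square integrable on $[0,1]\times[s,t]$ for all $s\le t$ in $T$, write $v=u^h$ on $T$ if $v\in C(T;E)$ solves on $T$ $$\partial_t v-\partial_{xx}v+\alpha v=f(x,v)+\sigma(x,v)\dot h+\eta-\xi,\qquad \partial_x v(0,t)=\partial_x v(1,t)=0,$$ for some measures $\eta,\xi\ge0$ on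 $[0,1]\times T$ that are finite on $[0,1]\times[s,t]$ for all $s\le t$ in $T$ and satisfy $\int_{[0,1]\times T}(v-K_1)\,d\eta=\int_{[0,1]\times T}(K_2-v)\,d\xi=0$. The equation is understood weakly: for all $s\le t$ in $T$ and all $\phi\in C^\infty([0,1])$ with $\phi'(0)=\phi'(1)=0$, $$\int_0^1 (v(x,t)-v(x,s))\phi(x)\,dx=\int_s^t\!\!\int_0^1\big(v\phi''-\alpha v\phi+f(x,v)\phi+\sigma(x,v)\dot h\,\phi\big)dx\,dr+\int_{[0,1]\times(s,t]}\phi\,d\eta-\int_{[0,1]\times(s,t]}\phi\,d\xi .$$ Define $$I_{t_1}^{t_2}(v)=\inf\Big\{\tfrac12\int_{T}\int_0^1\dot h^2\,dx\,dt:\ v=u^h \text{ on } T\Big\}\in[0,\infty],\qquad \inf\emptyset=\infty ,$$ and, for $z\in E$, $$J(z)=\inf\{I_0^t(v):\ t>0,\ v\in C([0,t];E),\ v(\cdot,0)=0,\ v(\cdot,t)=z\}.$$ **Theorem.** For every $z\in E$, $$J(z)=\inf\Big\{I_{-\infty}^0(v):\ v\in C((-\infty,0];C([0,1])),\ v(\cdot,0)=z,\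 \lim_{t\to-\infty}\|v(\cdot,t)\|_\infty=0\Big\}.$$ -/

import Mathlib

open MeasureTheory Set Filter Topology
open scoped ENNReal ContDiff

namespace ReflectedSkeleton

/-- The data of the reflected equation on the space interval `[0,1]`: the constant `α`, the
coefficients `f(x,y)`, `σ(x,y)`, and the lower and upper walls `K₁`, `K₂`.
No property is assumed here. -/
structure Data where
  α : ℝ
  f : unitInterval → ℝ → ℝ
  σ : unitInterval → ℝ → ℝ
  K₁ : C(unitInterval, ℝ)
  K₂ : C(unitInterval, ℝ)

/-- `K₁ < 0 < K₂` on `[0,1]`. -/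
def H1 (D : Data) : Prop :=
  ∀ x : unitInterval, D.K₁ x < 0 ∧ 0 < D.K₂ x

/-- The second distributional derivative of `K` on `(0,1)` belongs to `L²`. -/
def HasL2SecondDeriv (K : C(unitInterval, ℝ)) : Prop :=
  ∃ g : unitInterval → ℝ, MemLp g 2 ∧
    ∀ φ : ℝ → ℝ, ContDiff ℝ ∞ φ → HasCompactSupport φ → tsupport φ ⊆ Ioo 0 1 →
      ∫ x : unitInterval, K x * iteratedDeriv 2 φ x = ∫ x : unitInterval, g x * φ x

/-- Both walls have an `L²` second distributional derivative. -/
def H2 (D : Data) : Prop :=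
  HasL2SecondDeriv D.K₁ ∧ HasL2SecondDeriv D.K₂

/-- `f` and `σ` are bounded, and Lipschitz in the second variable uniformly in the first one.
Measurability of `f` in `x` (implicit in the equation) is included. -/
def F1 (D : Data) : Prop :=
  (∀ y : ℝ, Measurable fun x => D.f x y) ∧
  (∃ M : ℝ, ∀ x y, |D.f x y| ≤ M ∧ |D.σ x y| ≤ M) ∧
  ∃ C : ℝ, 0 < C ∧ ∀ (x : unitInterval) (y y' : ℝ),
    |D.f x y - D.f x y'| + |D.σ x y - D.σ x y'| ≤ C * |y - y'|

/-- `σ` is jointly continuous and bounded away from zero. -/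
def F2 (D : Data) : Prop :=
  Continuous (fun p : unitInterval × ℝ => D.σ p.1 p.2) ∧ ∃ m : ℝ, 0 < m ∧ ∀ x y, m ≤ |D.σ x y|

/-- The state space `E` of continuous functions on `[0,1]` lying between the two walls. -/
def E (D : Data) : Set C(unitInterval, ℝ) :=
  {z | ∀ x, D.K₁ x ≤ z x ∧ z x ≤ D.K₂ x}

/-- Smooth test functions on `[0,1]` with vanishing derivative at both end points (a smooth
function on `[0,1]` is the restriction of a smooth function on `ℝ`). -/
def IsNeumannTest (φ : ℝ → ℝ) : Prop :=
  ContDiff ℝ ∞ φ ∧ deriv φ 0 = 0 ∧ deriv φ 1 = 0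

/-- `v` solves, on the time interval `T`, the skeleton equation
`∂ₜv - ∂ₓₓv + αv = f(x,v) + σ(x,v) h + η - ξ`, `K₁ ≤ v ≤ K₂`, with Neumann boundary conditions,
driven by `h` (the function `ḣ`, of class `L²` on bounded time intervals) and with
reflection measures `η`, `ξ` acting only where `v = K₁`, respectively `v = K₂`.
The path is written as `v : time → C([0,1])`; only its values on `T` matter. The equation is
understood in the weak sense between any two times of `T`. -/
structure IsSolutionWith (D : Data) (T : Set ℝ) (h : unitInterval × ℝ → ℝ)
    (v : ℝ → C(unitInterval, ℝ)) (η ξ : Measure (unitInterval × ℝ)) : Prop where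
  control : ∀ s ∈ T, ∀ t ∈ T, MemLp h 2 (volume.restrict (univ ×ˢ Icc s t))
  continuousOn : ContinuousOn v T
  mem_E : ∀ t ∈ T, v t ∈ E D
  finite_η : ∀ s ∈ T, ∀ t ∈ T, η (univ ×ˢ Icc s t) < ⊤
  finite_ξ : ∀ s ∈ T, ∀ t ∈ T, ξ (univ ×ˢ Icc s t) < ⊤
  weak : ∀ φ : ℝ → ℝ, IsNeumannTest φ → ∀ s ∈ T, ∀ t ∈ T, s ≤ t →
    (∫ x : unitInterval, v t x * φ x) - ∫ x : unitInterval, v s x * φ x =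
      (∫ p in (univ : Set unitInterval) ×ˢ Ioc s t,
        (v p.2 p.1 * iteratedDeriv 2 φ p.1 - D.α * v p.2 p.1 * φ p.1
          + D.f p.1 (v p.2 p.1) * φ p.1 + D.σ p.1 (v p.2 p.1) * h p * φ p.1))
      + (∫ p in (univ : Set unitInterval) ×ˢ Ioc s t, φ p.1 ∂η)
      - ∫ p in (univ : Set unitInterval) ×ˢ Ioc s t, φ p.1 ∂ξ
  reflect_η : ∫⁻ p in (univ : Set unitInterval) ×ˢ T, ENNReal.ofReal (v p.2 p.1 - D.K₁ p.1) ∂η = 0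
  reflect_ξ : ∫⁻ p in (univ : Set unitInterval) ×ˢ T, ENNReal.ofReal (D.K₂ p.1 - v p.2 p.1) ∂ξ = 0

/-- `v = u^h` on the time interval `T`. -/
def IsSolution (D : Data) (T : Set ℝ) (h : unitInterval × ℝ → ℝ)
    (v : ℝ → C(unitInterval, ℝ)) : Prop :=
  ∃ η ξ : Measure (unitInterval × ℝ), IsSolutionWith D T h v η ξ

/-- The energy `½ |h|²` in `L²([0,1] × T)`, possibly infinite. -/
noncomputable def energy (T : Set ℝ) (h : unitInterval × ℝ → ℝ) : ℝ≥0∞ :=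
  2⁻¹ * ∫⁻ p in (univ : Set unitInterval) ×ˢ T, ENNReal.ofReal (h p ^ 2)

/-- The action of the path `v` on the time interval `T`: the least energy of a control `h`
with `v = u^h` on `T`, and `∞` if there is none. -/
noncomputable def action (D : Data) (T : Set ℝ) (v : ℝ → C(unitInterval, ℝ)) : ℝ≥0∞ :=
  ⨅ (h : unitInterval × ℝ → ℝ) (_ : IsSolution D T h v), energy T h

/-- The quasipotential
`J(z) = inf {I_0^t(v) ; v ∈ C([0,t];E), v(0) = 0, v(t) = z, t > 0}`. -/
noncomputable def J (D : Data) (z : C(unitInterval, ℝ)) : ℝ≥0∞ :=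
  ⨅ (t : ℝ) (_ : 0 < t) (v : ℝ → C(unitInterval, ℝ))
    (_ : ContinuousOn v (Icc 0 t) ∧ (∀ s ∈ Icc 0 t, v s ∈ E D) ∧ v 0 = 0 ∧ v t = z),
    action D (Icc 0 t) v

end ReflectedSkeleton

/-!
# The quasipotential as an infimum over paths from `-∞`

Since `f(x, 0) = 0`, the zero path is an uncontrolled solution. Both inequalities come from
concatenating solutions in time (`IsSolution.concat`) and from the autonomy of the equation
(`IsSolutionWith.shift`).

A path from `0` to `z` on `[0, t]`, translated to `[-t, 0]` and preceded by the zero path, is a path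
on `(-∞, 0]` with the same action (`iInf_action_le_J`).

Conversely, let `v` on `(-∞, 0]` end at `z`, vanish at `-∞`, and be driven by a control `h` of finite
energy (`J_le_iInf_action`). In the remote past `v` is uniformly small, so it stays away from the
walls and the reflection measures vanish there (`measure_eq_zero_of_gap`). On a time interval
`[c, c + 1]` of this kind replace `v` by `w(t) = (t - c) v(t)`. The equation without reflection is
linear in the derivatives of `v`, and `σ` is bounded away from zero, so `w` is again a solution,
driven by
`((t - c) f(x,v) - f(x,w) + (t - c) σ(x,v) h + v) / σ(x,w)` (`IsSolutionWith.ramp`). In particular no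
regularity of `v(c + 1)` is needed to connect it with `0`. The new control is bounded by a constant
times `sup |v| + |h|` (`exists_abs_rampControl_le`), so that its energy on `[c, c + 1]` tends to zero
as `c → -∞` (`energy_rampControl_le`, `tendsto_energy_atBot`). The path which is `w` on `[c, c + 1]`
and `v` on `[c + 1, 0]` joins `0` to `z` in finite time, at a cost which exceeds the energy of `h` by
an arbitrarily small amount.
-/

namespace ReflectedSkeleton

/-! ### The integrand of the weak formulation -/

/-- The density of `∂ₜ ∫ v φ` in the weak formulation, apart from the reflection terms. -/
noncomputable def weakIntegrand (D : Data) (h : unitInterval × ℝ → ℝ)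
    (v : ℝ → C(unitInterval, ℝ)) (φ : ℝ → ℝ) (p : unitInterval × ℝ) : ℝ :=
  v p.2 p.1 * iteratedDeriv 2 φ p.1 - D.α * v p.2 p.1 * φ p.1
    + D.f p.1 (v p.2 p.1) * φ p.1 + D.σ p.1 (v p.2 p.1) * h p * φ p.1

lemma volume_restrict_univ_prod (S : Set ℝ) :
    (volume : Measure (unitInterval × ℝ)).restrict (univ ×ˢ S) =
      (volume : Measure unitInterval).prod (volume.restrict S) := by
  rw [Measure.volume_eq_prod, ← Measure.prod_restrict, Measure.restrict_univ]

lemma setIntegral_univ_prod {F : unitInterval × ℝ → ℝ} {S : Set ℝ}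
    (hF : IntegrableOn F (univ ×ˢ S)) :
    ∫ p in univ ×ˢ S, F p = ∫ r in S, ∫ x, F (x, r) := by
  rw [IntegrableOn, volume_restrict_univ_prod] at hF
  rw [volume_restrict_univ_prod, integral_prod_symm _ hF]

instance isFiniteMeasure_restrict_univ_prod_Icc (s t : ℝ) :
    IsFiniteMeasure ((volume : Measure (unitInterval × ℝ)).restrict (univ ×ˢ Icc s t)) := by
  rw [volume_restrict_univ_prod]
  infer_instance

/-- `f` is a Carathéodory function, hence jointly measurable. -/
lemma F1.measurable_f {D : Data} (hF1 : F1 D) :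
    Measurable fun p : unitInterval × ℝ => D.f p.1 p.2 := by
  obtain ⟨hmeas, -, C, hC, hL⟩ := hF1
  have hc : ∀ x, Continuous fun y => D.f x y := fun x => by
    refine (LipschitzWith.of_dist_le_mul (K := C.toNNReal) fun y y' => ?_).continuous
    rw [Real.dist_eq, Real.dist_eq, Real.coe_toNNReal _ hC.le]
    have := hL x y y'
    have := abs_nonneg (D.σ x y - D.σ x y')
    linarith
  have := measurable_uncurry_of_continuous_of_measurable (u := fun y x => D.f x y) hc hmeas
  exact this.comp measurable_swap

lemma continuousOn_eval {v : ℝ → C(unitInterval, ℝ)} {S : Set ℝ} (hv : ContinuousOn v S) :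
    ContinuousOn (fun p : unitInterval × ℝ => v p.2 p.1) (univ ×ˢ S) :=
  (hv.comp continuousOn_snd fun _ hp => hp.2).eval continuousOn_fst

lemma aestronglyMeasurable_eval {v : ℝ → C(unitInterval, ℝ)} {s t : ℝ}
    (hv : ContinuousOn v (Icc s t)) :
    AEStronglyMeasurable (fun p : unitInterval × ℝ => v p.2 p.1)
      (volume.restrict (univ ×ˢ Icc s t)) :=
  (continuousOn_eval hv).aestronglyMeasurable (MeasurableSet.univ.prod measurableSet_Icc)

lemma abs_le_of_mem_E {D : Data} {u : C(unitInterval, ℝ)} (hu : u ∈ E D) (x : unitInterval) :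
    |u x| ≤ ‖D.K₁‖ + ‖D.K₂‖ := by
  have h1 := hu x
  have h2 := D.K₁.norm_coe_le_norm x
  have h3 := D.K₂.norm_coe_le_norm x
  rw [Real.norm_eq_abs] at h2 h3
  rw [abs_le] at h2 h3 ⊢
  constructor <;> linarith [norm_nonneg D.K₁, norm_nonneg D.K₂]

lemma exists_bound_on_unitInterval {φ : ℝ → ℝ} (hφ : Continuous φ) :
    ∃ B, ∀ x : unitInterval, ‖φ x‖ ≤ B := by
  obtain ⟨B, hB⟩ := isCompact_univ.exists_bound_of_continuousOn
    (f := fun x : unitInterval => φ x) (by fun_prop)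
  exact ⟨B, fun x => hB x (mem_univ x)⟩

lemma IsNeumannTest.continuous {φ : ℝ → ℝ} (hφ : IsNeumannTest φ) : Continuous φ :=
  hφ.1.continuous

lemma integrableOn_eval_mul {D : Data} {v : ℝ → C(unitInterval, ℝ)} {s t : ℝ}
    (hv : ContinuousOn v (Icc s t)) (hE : ∀ r ∈ Icc s t, v r ∈ E D)
    {φ : ℝ → ℝ} (hφ : Continuous φ) :
    IntegrableOn (fun p : unitInterval × ℝ => v p.2 p.1 * φ p.1) (univ ×ˢ Icc s t) := by
  obtain ⟨B, hB⟩ := exists_bound_on_unitInterval hφ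
  refine Integrable.of_bound ((aestronglyMeasurable_eval hv).mul
    (Continuous.aestronglyMeasurable (by fun_prop))) ((‖D.K₁‖ + ‖D.K₂‖) * B) ?_
  filter_upwards [ae_restrict_mem (MeasurableSet.univ.prod measurableSet_Icc)] with p hp
  rw [norm_mul]
  exact mul_le_mul (abs_le_of_mem_E (hE _ hp.2) _) (hB _) (norm_nonneg _) (by positivity)

lemma integrableOn_weakIntegrand {D : Data} (hF1 : F1 D) (hF2 : F2 D)
    {h : unitInterval × ℝ → ℝ} {v : ℝ → C(unitInterval, ℝ)} {s t : ℝ}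
    (hh : MemLp h 2 (volume.restrict (univ ×ˢ Icc s t)))
    (hv : ContinuousOn v (Icc s t)) (hE : ∀ r ∈ Icc s t, v r ∈ E D)
    {φ : ℝ → ℝ} (hφ : IsNeumannTest φ) :
    IntegrableOn (weakIntegrand D h v φ) (univ ×ˢ Icc s t) := by
  have hfm := hF1.measurable_f
  obtain ⟨-, ⟨M, hM⟩, -⟩ := hF1
  obtain ⟨B, hB⟩ := exists_bound_on_unitInterval hφ.continuous
  have hvm := aestronglyMeasurable_eval hv
  have hM0 : 0 ≤ M := (abs_nonneg _).trans (hM 0 0).1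
  have hφm : AEStronglyMeasurable (fun p : unitInterval × ℝ => φ p.1)
      (volume.restrict (univ ×ˢ Icc s t)) := by
    have := hφ.continuous
    exact Continuous.aestronglyMeasurable (by fun_prop)
  have i1 := integrableOn_eval_mul hv hE (hφ.1.continuous_iteratedDeriv 2 (by norm_cast))
  have i2 := integrableOn_eval_mul hv hE hφ.continuous
  have i3 : IntegrableOn (fun p : unitInterval × ℝ => D.f p.1 (v p.2 p.1) * φ p.1)
      (univ ×ˢ Icc s t) := by
    refine Integrable.of_bound (AEStronglyMeasurable.mul ?_ hφm) (M * B) ?_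
    · exact (hfm.comp_aemeasurable (measurable_fst.aemeasurable.prodMk
        hvm.aemeasurable)).aestronglyMeasurable
    · refine Eventually.of_forall fun p => ?_
      rw [norm_mul]
      exact mul_le_mul (hM _ _).1 (hB _) (norm_nonneg _) hM0
  have i4 : IntegrableOn (fun p : unitInterval × ℝ => D.σ p.1 (v p.2 p.1) * h p * φ p.1)
      (univ ×ˢ Icc s t) := by
    have hi : Integrable h (volume.restrict (univ ×ˢ Icc s t)) := hh.integrable (by norm_num)
    refine Integrable.mul_bdd (c := B) (Integrable.bdd_mul (c := M) hi ?_ ?_) hφm ?_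
    · exact (hF2.1.measurable.comp_aemeasurable (measurable_fst.aemeasurable.prodMk
        hvm.aemeasurable)).aestronglyMeasurable
    · exact Eventually.of_forall fun p => (hM _ _).2
    · exact Eventually.of_forall fun p => hB _
  refine (((i1.sub (i2.const_mul D.α)).add i3).add i4).congr (Eventually.of_forall fun p => ?_)
  simp only [weakIntegrand, Pi.add_apply, Pi.sub_apply]
  ring

/-! ### Restriction, modification and translation of solutions -/

section
variable {D : Data} {T : Set ℝ} {h : unitInterval × ℝ → ℝ} {v : ℝ → C(unitInterval, ℝ)}
  {η ξ : Measure (unitInterval × ℝ)}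

lemma IsSolutionWith.mono (H : IsSolutionWith D T h v η ξ) {T' : Set ℝ} (hT : T' ⊆ T) :
    IsSolutionWith D T' h v η ξ where
  control s hs t ht := H.control s (hT hs) t (hT ht)
  continuousOn := H.continuousOn.mono hT
  mem_E t ht := H.mem_E t (hT ht)
  finite_η s hs t ht := H.finite_η s (hT hs) t (hT ht)
  finite_ξ s hs t ht := H.finite_ξ s (hT hs) t (hT ht)
  weak φ hφ s hs t ht := H.weak φ hφ s (hT hs) t (hT ht)
  reflect_η := le_antisymm
    ((lintegral_mono_set (prod_mono subset_rfl hT)).trans H.reflect_η.le) zero_le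
  reflect_ξ := le_antisymm
    ((lintegral_mono_set (prod_mono subset_rfl hT)).trans H.reflect_ξ.le) zero_le

lemma IsSolutionWith.congr (H : IsSolutionWith D T h v η ξ) (hT : T.OrdConnected)
    {h' : unitInterval × ℝ → ℝ} {v' : ℝ → C(unitInterval, ℝ)}
    (hh : ∀ᵐ p : unitInterval × ℝ, p.2 ∈ T → h p = h' p) (hv : EqOn v v' T) :
    IsSolutionWith D T h' v' η ξ where
  control s hs t ht := by
    refine (H.control s hs t ht).ae_eq ?_
    filter_upwards [ae_restrict_mem (MeasurableSet.univ.prod measurableSet_Icc),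
      ae_restrict_of_ae hh] with p hp hp'
    exact hp' (hT.out hs ht hp.2)
  continuousOn := H.continuousOn.congr hv.symm
  mem_E t ht := hv ht ▸ H.mem_E t ht
  finite_η := H.finite_η
  finite_ξ := H.finite_ξ
  weak φ hφ s hs t ht hst := by
    rw [← hv hs, ← hv ht, H.weak φ hφ s hs t ht hst]
    congr 2
    refine integral_congr_ae ?_
    filter_upwards [ae_restrict_mem (MeasurableSet.univ.prod measurableSet_Ioc),
      ae_restrict_of_ae hh] with p hp hp'
    have hpT := hT.out hs ht (Ioc_subset_Icc_self hp.2)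
    rw [hp' hpT, hv hpT]
  reflect_η := by
    rw [← H.reflect_η]
    have hm : MeasurableSet ((univ : Set unitInterval) ×ˢ T) :=
      MeasurableSet.univ.prod hT.measurableSet
    exact setLIntegral_congr_fun hm fun p hp => by simp only [hv hp.2]
  reflect_ξ := by
    rw [← H.reflect_ξ]
    have hm : MeasurableSet ((univ : Set unitInterval) ×ˢ T) :=
      MeasurableSet.univ.prod hT.measurableSet
    exact setLIntegral_congr_fun hm fun p hp => by simp only [hv hp.2]

/-- Translation of the time variable by `c`, as a measurable equivalence of `[0,1] × ℝ`. -/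
noncomputable def timeShift (c : ℝ) : unitInterval × ℝ ≃ᵐ unitInterval × ℝ :=
  (MeasurableEquiv.refl _).prodCongr (MeasurableEquiv.addRight c)

lemma timeShift_apply (c : ℝ) (p : unitInterval × ℝ) : timeShift c p = (p.1, p.2 + c) := rfl

lemma measurePreserving_timeShift (c : ℝ) : MeasurePreserving (timeShift c) :=
  (MeasurePreserving.id volume).prod (measurePreserving_add_right volume c)

lemma timeShift_preimage (c : ℝ) (S : Set ℝ) :
    timeShift c ⁻¹' (univ ×ˢ S) = univ ×ˢ ((· + c) ⁻¹' S) := by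
  ext p; simp [timeShift_apply]

lemma measurePreserving_timeShift_symm_map (c : ℝ) (η : Measure (unitInterval × ℝ)) :
    MeasurePreserving (timeShift c) (η.map (timeShift c).symm) η :=
  ⟨(timeShift c).measurable, by simp⟩

/-- The equation is autonomous. -/
lemma IsSolutionWith.shift (H : IsSolutionWith D T h v η ξ) (c : ℝ) :
    IsSolutionWith D ((· + c) ⁻¹' T) (h ∘ timeShift c) (fun t => v (t + c))
      (η.map (timeShift c).symm) (ξ.map (timeShift c).symm) where
  control s hs t ht := by
    have h1 := (measurePreserving_timeShift c).restrict_preimage_emb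
      (timeShift c).measurableEmbedding (univ ×ˢ Icc (s + c) (t + c))
    rw [timeShift_preimage, preimage_add_const_Icc, add_sub_cancel_right,
      add_sub_cancel_right] at h1
    exact (H.control _ hs _ ht).comp_measurePreserving h1
  continuousOn := H.continuousOn.comp (by fun_prop) fun _ ht => ht
  mem_E t ht := H.mem_E _ ht
  finite_η s hs t ht := by
    have := H.finite_η _ hs _ ht
    rwa [← (measurePreserving_timeShift_symm_map c η).measure_preimage_equiv,
      timeShift_preimage, preimage_add_const_Icc, add_sub_cancel_right,
      add_sub_cancel_right] at this
  finite_ξ s hs t ht := by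
    have := H.finite_ξ _ hs _ ht
    rwa [← (measurePreserving_timeShift_symm_map c ξ).measure_preimage_equiv,
      timeShift_preimage, preimage_add_const_Icc, add_sub_cancel_right,
      add_sub_cancel_right] at this
  weak φ hφ s hs t ht hst := by
    have := H.weak φ hφ _ hs _ ht (by simpa using hst)
    rwa [← (measurePreserving_timeShift_symm_map c ξ).setIntegral_preimage_emb
        (timeShift c).measurableEmbedding,
      ← (measurePreserving_timeShift_symm_map c η).setIntegral_preimage_emb
        (timeShift c).measurableEmbedding,
      ← (measurePreserving_timeShift c).setIntegral_preimage_emb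
        (timeShift c).measurableEmbedding,
      timeShift_preimage, preimage_add_const_Ioc, add_sub_cancel_right,
      add_sub_cancel_right] at this
  reflect_η := by
    have := H.reflect_η
    rwa [← (measurePreserving_timeShift_symm_map c η).setLIntegral_comp_preimage_emb
      (timeShift c).measurableEmbedding, timeShift_preimage] at this
  reflect_ξ := by
    have := H.reflect_ξ
    rwa [← (measurePreserving_timeShift_symm_map c ξ).setLIntegral_comp_preimage_emb
      (timeShift c).measurableEmbedding, timeShift_preimage] at this

lemma energy_shift (c : ℝ) (T : Set ℝ) (h : unitInterval × ℝ → ℝ) :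
    energy ((· + c) ⁻¹' T) (h ∘ timeShift c) = energy T h := by
  unfold energy
  rw [← timeShift_preimage]
  congr 1
  exact (measurePreserving_timeShift c).setLIntegral_comp_preimage_emb
    (timeShift c).measurableEmbedding (fun p => ENNReal.ofReal (h p ^ 2)) _

end

lemma isSolutionWith_zero {D : Data} (hH1 : H1 D) (hf0 : ∀ x, D.f x 0 = 0) (T : Set ℝ) :
    IsSolutionWith D T 0 0 0 0 where
  control s _ t _ := MemLp.zero
  continuousOn := continuousOn_const
  mem_E t _ x := ⟨(hH1 x).1.le, (hH1 x).2.le⟩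
  finite_η s _ t _ := by simp
  finite_ξ s _ t _ := by simp
  weak φ _ s _ t _ _ := by simp [hf0]
  reflect_η := by simp
  reflect_ξ := by simp

/-! ### Concatenation of solutions -/

section
variable {D : Data} {T₁ T₂ : Set ℝ} {b : ℝ} {h : unitInterval × ℝ → ℝ}
  {v : ℝ → C(unitInterval, ℝ)} {η₁ ξ₁ η₂ ξ₂ : Measure (unitInterval × ℝ)}

/-- The measure which is `η₁` up to time `b`, inclusive, and `η₂` afterwards. The weak formulation
integrates over intervals `(s, t]`, so an atom of `η₂` at time `b` must be dropped. -/
noncomputable def glueMeasure (b : ℝ) (η₁ η₂ : Measure (unitInterval × ℝ)) :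
    Measure (unitInterval × ℝ) :=
  η₁.restrict (univ ×ˢ Iic b) + η₂.restrict (univ ×ˢ Ioi b)

lemma glueMeasure_restrict (S : Set ℝ) :
    (glueMeasure b η₁ η₂).restrict (univ ×ˢ S) =
      η₁.restrict (univ ×ˢ (S ∩ Iic b)) + η₂.restrict (univ ×ˢ (S ∩ Ioi b)) := by
  rw [glueMeasure, Measure.restrict_add,
    Measure.restrict_restrict' (MeasurableSet.univ.prod measurableSet_Iic),
    Measure.restrict_restrict' (MeasurableSet.univ.prod measurableSet_Ioi),
    prod_inter_prod, prod_inter_prod, univ_inter]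

lemma glueMeasure_apply (S : Set ℝ) :
    glueMeasure b η₁ η₂ (univ ×ˢ S) =
      η₁ (univ ×ˢ (S ∩ Iic b)) + η₂ (univ ×ˢ (S ∩ Ioi b)) := by
  rw [← Measure.restrict_apply_univ, glueMeasure_restrict, Measure.add_apply,
    Measure.restrict_apply_univ, Measure.restrict_apply_univ]

lemma Ioc_inter_Iic_eq (s t b : ℝ) : Ioc s t ∩ Iic b = Ioc (s ⊓ b) (t ⊓ b) := by
  ext r
  simp only [mem_inter_iff, mem_Ioc, mem_Iic, le_inf_iff, inf_lt_iff]
  constructor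
  · rintro ⟨⟨h1, h2⟩, h3⟩; exact ⟨Or.inl h1, h2, h3⟩
  · rintro ⟨h1 | h1, h2, h3⟩
    · exact ⟨⟨h1, h2⟩, h3⟩
    · exact absurd h3 h1.not_ge

lemma Ioc_inter_Ioi_eq (s t b : ℝ) : Ioc s t ∩ Ioi b = Ioc (s ⊔ b) (t ⊔ b) := by
  ext r
  simp only [mem_inter_iff, mem_Ioc, mem_Ioi, sup_lt_iff, le_sup_iff]
  constructor
  · rintro ⟨⟨h1, h2⟩, h3⟩; exact ⟨⟨h1, h3⟩, Or.inl h2⟩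
  · rintro ⟨⟨h1, h2⟩, h3 | h3⟩
    · exact ⟨⟨h1, h3⟩, h2⟩
    · exact absurd h3 h2.not_ge

lemma inf_mem_of_mem_union (h₁ : T₁ ⊆ Iic b) (hb : b ∈ T₁) (h₂ : T₂ ⊆ Ici b) {s : ℝ}
    (hs : s ∈ T₁ ∪ T₂) : s ⊓ b ∈ T₁ := by
  rcases hs with hs | hs
  · rwa [inf_eq_left.2 (h₁ hs)]
  · rwa [inf_eq_right.2 (h₂ hs)]

lemma sup_mem_of_mem_union (h₁ : T₁ ⊆ Iic b) (h₂ : T₂ ⊆ Ici b) (hb : b ∈ T₂) {s : ℝ}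
    (hs : s ∈ T₁ ∪ T₂) : s ⊔ b ∈ T₂ := by
  rcases hs with hs | hs
  · rwa [sup_eq_right.2 (h₁ hs)]
  · rwa [sup_eq_left.2 (h₂ hs)]

lemma glueMeasure_Icc_lt_top (hT₁ : T₁ ⊆ Iic b) (hb₁ : b ∈ T₁) (hT₂ : T₂ ⊆ Ici b) (hb₂ : b ∈ T₂)
    (H₁ : ∀ s ∈ T₁, ∀ t ∈ T₁, η₁ (univ ×ˢ Icc s t) < ⊤)
    (H₂ : ∀ s ∈ T₂, ∀ t ∈ T₂, η₂ (univ ×ˢ Icc s t) < ⊤) {s t : ℝ}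
    (hs : s ∈ T₁ ∪ T₂) (ht : t ∈ T₁ ∪ T₂) :
    glueMeasure b η₁ η₂ (univ ×ˢ Icc s t) < ⊤ := by
  rw [glueMeasure_apply]
  refine ENNReal.add_lt_top.2 ⟨?_, ?_⟩
  · refine (measure_mono (prod_mono subset_rfl ?_)).trans_lt
      (H₁ _ (inf_mem_of_mem_union hT₁ hb₁ hT₂ hs) _ (inf_mem_of_mem_union hT₁ hb₁ hT₂ ht))
    exact fun r hr => ⟨inf_le_left.trans hr.1.1, le_inf hr.1.2 hr.2⟩
  · refine (measure_mono (prod_mono subset_rfl ?_)).trans_lt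
      (H₂ _ (sup_mem_of_mem_union hT₁ hT₂ hb₂ hs) _ (sup_mem_of_mem_union hT₁ hT₂ hb₂ ht))
    exact fun r hr => ⟨sup_le hr.1.1 (le_of_lt hr.2), hr.1.2.trans le_sup_left⟩

lemma lintegral_glueMeasure_eq_zero (hT₁ : T₁ ⊆ Iic b) (hb₁ : b ∈ T₁) (hT₂ : T₂ ⊆ Ici b)
    {F : unitInterval × ℝ → ℝ≥0∞} (H₁ : ∫⁻ p in univ ×ˢ T₁, F p ∂η₁ = 0)
    (H₂ : ∫⁻ p in univ ×ˢ T₂, F p ∂η₂ = 0) :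
    ∫⁻ p in univ ×ˢ (T₁ ∪ T₂), F p ∂(glueMeasure b η₁ η₂) = 0 := by
  rw [glueMeasure_restrict, lintegral_add_measure, add_eq_zero]
  constructor
  · refine le_antisymm ((lintegral_mono_set (prod_mono subset_rfl ?_)).trans H₁.le) zero_le
    rintro r ⟨hr | hr, hrb⟩
    · exact hr
    · rwa [le_antisymm hrb (mem_Ici.1 (hT₂ hr))]
  · refine le_antisymm ((lintegral_mono_set (prod_mono subset_rfl ?_)).trans H₂.le) zero_le
    rintro r ⟨hr | hr, hrb⟩
    · exact absurd (mem_Iic.1 (hT₁ hr)) (not_le.2 hrb)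
    · exact hr

lemma setIntegral_glueMeasure {s t : ℝ} {φ : ℝ → ℝ} (hφ : Continuous φ)
    (hf₁ : η₁ (univ ×ˢ Icc (s ⊓ b) (t ⊓ b)) < ⊤) (hf₂ : η₂ (univ ×ˢ Icc (s ⊔ b) (t ⊔ b)) < ⊤) :
    ∫ p in (univ : Set unitInterval) ×ˢ Ioc s t, φ p.1 ∂(glueMeasure b η₁ η₂) =
      (∫ p in (univ : Set unitInterval) ×ˢ Ioc (s ⊓ b) (t ⊓ b), φ p.1 ∂η₁)
        + ∫ p in (univ : Set unitInterval) ×ˢ Ioc (s ⊔ b) (t ⊔ b), φ p.1 ∂η₂ := by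
  obtain ⟨B, hB⟩ := exists_bound_on_unitInterval hφ
  have key : ∀ (η : Measure (unitInterval × ℝ)) (s t : ℝ), η (univ ×ˢ Icc s t) < ⊤ →
      Integrable (fun p : unitInterval × ℝ => φ p.1) (η.restrict (univ ×ˢ Ioc s t)) := by
    intro η s t hη
    have : IsFiniteMeasure (η.restrict (univ ×ˢ Ioc s t)) := ⟨by
      rw [Measure.restrict_apply_univ]
      exact (measure_mono (prod_mono subset_rfl Ioc_subset_Icc_self)).trans_lt hη⟩
    exact Integrable.of_bound (Continuous.aestronglyMeasurable (by fun_prop)) B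
      (Eventually.of_forall fun p => hB _)
  rw [glueMeasure_restrict, Ioc_inter_Iic_eq, Ioc_inter_Ioi_eq,
    integral_add_measure (key _ _ _ hf₁) (key _ _ _ hf₂)]

/-- Solutions on two adjacent time intervals, driven by the same control, form a solution on the
union. -/
lemma IsSolutionWith.union (hF1 : F1 D) (hF2 : F2 D)
    (ho₁ : T₁.OrdConnected) (hT₁ : T₁ ⊆ Iic b) (hb₁ : b ∈ T₁)
    (ho₂ : T₂.OrdConnected) (hT₂ : T₂ ⊆ Ici b) (hb₂ : b ∈ T₂)
    (A₁ : IsSolutionWith D T₁ h v η₁ ξ₁) (A₂ : IsSolutionWith D T₂ h v η₂ ξ₂) :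
    IsSolutionWith D (T₁ ∪ T₂) h v (glueMeasure b η₁ η₂) (glueMeasure b ξ₁ ξ₂) := by
  -- Every interval from `s` to `t` is cut at `b` into the intervals from `s ⊓ b` to `t ⊓ b` and from
  -- `s ⊔ b` to `t ⊔ b`, one of which may be degenerate; no case distinction is then needed.
  have hinf : ∀ {s}, s ∈ T₁ ∪ T₂ → s ⊓ b ∈ T₁ := inf_mem_of_mem_union hT₁ hb₁ hT₂
  have hsup : ∀ {s}, s ∈ T₁ ∪ T₂ → s ⊔ b ∈ T₂ := sup_mem_of_mem_union hT₁ hT₂ hb₂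
  have hE : ∀ t ∈ T₁ ∪ T₂, v t ∈ E D := fun t ht => ht.elim (A₁.mem_E t) (A₂.mem_E t)
  have hc : ContinuousOn v (T₁ ∪ T₂) := by
    intro t ht
    -- A time in one of the intervals only is at a positive distance from the other one.
    have aux : ∀ {S : Set ℝ}, ContinuousOn v S → (t ∈ closure S → t ∈ S) →
        ContinuousWithinAt v S t := by
      intro S hS htS
      by_cases h : t ∈ closure S
      · exact hS t (htS h)
      · exact continuousWithinAt_of_notMem_closure h
    refine ContinuousWithinAt.union (aux A₁.continuousOn fun h => ?_)
      (aux A₂.continuousOn fun h => ?_)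
    · have h' : t ≤ b := closure_minimal hT₁ isClosed_Iic h
      simpa [inf_eq_left.2 h'] using hinf ht
    · have h' : b ≤ t := closure_minimal hT₂ isClosed_Ici h
      simpa [sup_eq_left.2 h'] using hsup ht
  have hm : MeasurableSet ((univ : Set unitInterval) ×ˢ Iic b) :=
    MeasurableSet.univ.prod measurableSet_Iic
  have hcontrol : ∀ s ∈ T₁ ∪ T₂, ∀ t ∈ T₁ ∪ T₂,
      MemLp h 2 (volume.restrict (univ ×ˢ Icc s t)) := by
    intro s hs t ht
    rw [← piecewise_same ((univ : Set unitInterval) ×ˢ Iic b) h]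
    refine MemLp.piecewise hm ?_ ?_
    · refine (A₁.control _ (hinf hs) _ (hinf ht)).mono_measure ?_
      rw [Measure.restrict_restrict hm]
      refine Measure.restrict_mono (fun p hp => ?_) le_rfl
      exact ⟨mem_univ _, inf_le_left.trans hp.2.2.1, le_inf hp.2.2.2 hp.1.2⟩
    · refine (A₂.control _ (hsup hs) _ (hsup ht)).mono_measure ?_
      rw [Measure.restrict_restrict hm.compl]
      refine Measure.restrict_mono (fun p hp => ?_) le_rfl
      have : b < p.2 := by simpa using hp.1
      exact ⟨mem_univ _, sup_le hp.2.2.1 this.le, hp.2.2.2.trans le_sup_left⟩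
  have hoc : ∀ s ∈ T₁ ∪ T₂, ∀ t ∈ T₁ ∪ T₂, Icc s t ⊆ T₁ ∪ T₂ := by
    intro s hs t ht r hr
    rcases le_total r b with hrb | hrb
    · refine Or.inl (ho₁.out (hinf hs) hb₁ ⟨inf_le_left.trans hr.1, hrb⟩)
    · refine Or.inr (ho₂.out hb₂ (hsup ht) ⟨hrb, hr.2.trans le_sup_left⟩)
  refine ⟨hcontrol, hc, hE,
    fun s hs t ht => glueMeasure_Icc_lt_top hT₁ hb₁ hT₂ hb₂ A₁.finite_η A₂.finite_η hs ht,
    fun s hs t ht => glueMeasure_Icc_lt_top hT₁ hb₁ hT₂ hb₂ A₁.finite_ξ A₂.finite_ξ hs ht,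
    ?_, lintegral_glueMeasure_eq_zero hT₁ hb₁ hT₂ A₁.reflect_η A₂.reflect_η,
    lintegral_glueMeasure_eq_zero hT₁ hb₁ hT₂ A₁.reflect_ξ A₂.reflect_ξ⟩
  intro φ hφ s hs t ht hst
  have w₁ := A₁.weak φ hφ _ (hinf hs) _ (hinf ht) (inf_le_inf_right b hst)
  have w₂ := A₂.weak φ hφ _ (hsup hs) _ (hsup ht) (sup_le_sup_right hst b)
  have hsum : ∀ r : ℝ, (∫ x : unitInterval, v (r ⊓ b) x * φ x) +
      (∫ x : unitInterval, v (r ⊔ b) x * φ x) =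
      (∫ x : unitInterval, v r x * φ x) + ∫ x : unitInterval, v b x * φ x := by
    intro r
    rcases le_total r b with h | h
    · simp [h]
    · simp [h, add_comm]
  have hi : IntegrableOn (weakIntegrand D h v φ) (univ ×ˢ Ioc s t) :=
    (integrableOn_weakIntegrand hF1 hF2 (hcontrol s hs t ht) (hc.mono (hoc s hs t ht))
      (fun r hr => hE r (hoc s hs t ht hr)) hφ).mono_set
        (prod_mono subset_rfl Ioc_subset_Icc_self)
  have hsplit := integral_inter_add_sdiff hm hi
  have hd : ((univ : Set unitInterval) ×ˢ Ioc s t) \ (univ ×ˢ Iic b) =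
      univ ×ˢ Ioc (s ⊔ b) (t ⊔ b) := by
    rw [← Ioc_inter_Ioi_eq]
    ext p
    simp only [Set.mem_sdiff, mem_prod, mem_univ, true_and, mem_Iic, not_le, mem_inter_iff, mem_Ioi]
  rw [prod_inter_prod, univ_inter, Ioc_inter_Iic_eq, hd] at hsplit
  rw [setIntegral_glueMeasure hφ.continuous
      (A₁.finite_η _ (hinf hs) _ (hinf ht)) (A₂.finite_η _ (hsup hs) _ (hsup ht)),
    setIntegral_glueMeasure hφ.continuous
      (A₁.finite_ξ _ (hinf hs) _ (hinf ht)) (A₂.finite_ξ _ (hsup hs) _ (hsup ht))]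
  have e₁ := hsum s
  have e₂ := hsum t
  simp only [weakIntegrand] at hsplit
  linarith

/-- Two paths which agree at time `b`, with their controls, are concatenated at time `b`. -/
lemma IsSolution.concat {h₁ h₂ : unitInterval × ℝ → ℝ} {v₁ v₂ : ℝ → C(unitInterval, ℝ)}
    (hF1 : F1 D) (hF2 : F2 D)
    (ho₁ : T₁.OrdConnected) (hT₁ : T₁ ⊆ Iic b) (hb₁ : b ∈ T₁)
    (ho₂ : T₂.OrdConnected) (hT₂ : T₂ ⊆ Ici b) (hb₂ : b ∈ T₂)
    (A₁ : IsSolution D T₁ h₁ v₁) (A₂ : IsSolution D T₂ h₂ v₂) (hv : v₁ b = v₂ b) :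
    IsSolution D (T₁ ∪ T₂) (fun p => if p.2 ≤ b then h₁ p else h₂ p)
      (fun t => if t ≤ b then v₁ t else v₂ t) := by
  obtain ⟨η₁, ξ₁, A₁⟩ := A₁
  obtain ⟨η₂, ξ₂, A₂⟩ := A₂
  -- The value of the control at the single time `b` is irrelevant.
  have hne : ∀ᵐ p : unitInterval × ℝ, p.2 ≠ b :=
    Measure.quasiMeasurePreserving_snd.ae (Measure.ae_ne volume b)
  refine ⟨_, _, IsSolutionWith.union hF1 hF2 ho₁ hT₁ hb₁ ho₂ hT₂ hb₂
    (A₁.congr ho₁ (Eventually.of_forall fun p hp => ?_) fun t ht => ?_)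
    (A₂.congr ho₂ ?_ fun t ht => ?_)⟩
  · exact (if_pos (hT₁ hp)).symm
  · exact (if_pos (hT₁ ht)).symm
  · filter_upwards [hne] with p hp hpT
    exact (if_neg (not_le.2 (lt_of_le_of_ne (hT₂ hpT) hp.symm))).symm
  · rcases eq_or_lt_of_le (mem_Ici.1 (hT₂ ht)) with rfl | h
    · simpa using hv.symm
    · exact (if_neg (not_le.2 h)).symm

lemma energy_concat_le (hT₁ : MeasurableSet T₁) (hT₂ : MeasurableSet T₂)
    (hT₁b : T₁ ⊆ Iic b) (hT₂b : T₂ ⊆ Ici b) (h₁ h₂ : unitInterval × ℝ → ℝ) :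
    energy (T₁ ∪ T₂) (fun p => if p.2 ≤ b then h₁ p else h₂ p) ≤ energy T₁ h₁ + energy T₂ h₂ := by
  have hne : ∀ᵐ p : unitInterval × ℝ, p.2 ≠ b :=
    Measure.quasiMeasurePreserving_snd.ae (Measure.ae_ne volume b)
  unfold energy
  rw [← mul_add, prod_union]
  gcongr
  refine (lintegral_union_le _ _ _).trans (add_le_add (le_of_eq ?_) (le_of_eq ?_))
  · refine setLIntegral_congr_fun (MeasurableSet.univ.prod hT₁) fun p hp => ?_
    have : p.2 ≤ b := hT₁b hp.2
    simp [this]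
  · refine lintegral_congr_ae ?_
    filter_upwards [ae_restrict_mem (MeasurableSet.univ.prod hT₂), ae_restrict_of_ae hne]
      with p hp hp'
    have : ¬ p.2 ≤ b := not_le.2 (lt_of_le_of_ne (hT₂b hp.2) hp'.symm)
    simp [this]

end

/-! ### Paths switched on linearly in time -/

/-- Integration by parts of an absolutely continuous function against a linear weight. -/
lemma integral_linear_weight {a G : ℝ → ℝ} {c s t : ℝ} (hst : s ≤ t)
    (hG : IntervalIntegrable G volume s t)
    (ha : ∀ r ∈ Icc s t, a r = a s + ∫ u in s..r, G u) :
    (t - c) * a t - (s - c) * a s = ∫ r in s..t, ((r - c) * G r + a r) := by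
  set A : ℝ → ℝ := fun r => a s + ∫ u in s..r, G u with hA
  have hlin : AbsolutelyContinuousOnInterval (fun r => r - c) s t := by
    refine ContDiffOn.absolutelyContinuousOnInterval (E := ℝ) ?_
    exact (contDiff_id.sub contDiff_const).contDiffOn
  have hAC : AbsolutelyContinuousOnInterval A s t := by
    refine AbsolutelyContinuousOnInterval.fun_add ?_
      (hG.absolutelyContinuousOnInterval_intervalIntegral left_mem_uIcc)
    exact (contDiff_const.contDiffOn (𝕜 := ℝ)).absolutelyContinuousOnInterval
  have key := AbsolutelyContinuousOnInterval.integral_deriv_mul_eq_sub hlin hAC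
  have e1 : A t = a t := (ha t ⟨hst, le_rfl⟩).symm
  have e2 : A s = a s := (ha s ⟨le_rfl, hst⟩).symm
  rw [e1, e2] at key
  rw [← key]
  refine intervalIntegral.integral_congr_ae ?_
  filter_upwards [hG.ae_hasDerivAt_integral] with r hr hrst
  have hr' := uIoc_subset_uIcc hrst
  have hd : deriv A r = G r := ((hr hr' s left_mem_uIcc).const_add (a s)).deriv
  have hd' : deriv (fun r => r - c) r = 1 := by simp
  rw [hd, hd']
  rw [uIcc_of_le hst] at hr'
  have : A r = a r := (ha r hr').symm
  rw [this]
  ring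

/-- The path `(t - c) v(t)`, which on `[c, c + 1]` interpolates between `0` and `v(c + 1)`. -/
noncomputable def rampPath (v : ℝ → C(unitInterval, ℝ)) (c : ℝ) (t : ℝ) : C(unitInterval, ℝ) :=
  (t - c) • v t

/-- The control which drives `rampPath v c`, if `h` drives `v` without reflection. -/
noncomputable def rampControl (D : Data) (h : unitInterval × ℝ → ℝ) (v : ℝ → C(unitInterval, ℝ))
    (c : ℝ) (p : unitInterval × ℝ) : ℝ :=
  ((p.2 - c) * D.f p.1 (v p.2 p.1) - D.f p.1 (rampPath v c p.2 p.1)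
    + (p.2 - c) * D.σ p.1 (v p.2 p.1) * h p + v p.2 p.1) / D.σ p.1 (rampPath v c p.2 p.1)

lemma exists_abs_rampControl_le {D : Data} (hF1 : F1 D) (hF2 : F2 D) (hf0 : ∀ x, D.f x 0 = 0) :
    ∃ A B : ℝ, 0 ≤ A ∧ 0 ≤ B ∧
      ∀ (h : unitInterval × ℝ → ℝ) (v : ℝ → C(unitInterval, ℝ)) (c δ : ℝ) (p : unitInterval × ℝ),
        p.2 ∈ Icc c (c + 1) → ‖v p.2‖ ≤ δ → |rampControl D h v c p| ≤ A * δ + B * |h p| := by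
  obtain ⟨-, ⟨M, hM⟩, C, hC, hL⟩ := hF1
  obtain ⟨-, m, hm, hσ⟩ := hF2
  have hM0 : 0 ≤ M := (abs_nonneg _).trans (hM 0 0).1
  refine ⟨(2 * C + 1) / m, M / m, by positivity, by positivity, fun h v c δ p hp hv => ?_⟩
  have hθ0 : 0 ≤ p.2 - c := sub_nonneg.2 hp.1
  have hθ1 : p.2 - c ≤ 1 := by linarith [hp.2]
  have hf : ∀ x y, |D.f x y| ≤ C * |y| := fun x y => by
    have := hL x y 0
    rw [hf0, sub_zero, sub_zero] at this
    linarith [abs_nonneg (D.σ x y - D.σ x 0)]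
  have hvx : |v p.2 p.1| ≤ δ := ((v p.2).norm_coe_le_norm p.1).trans hv
  have hδ : 0 ≤ δ := (abs_nonneg _).trans hvx
  have hw : |rampPath v c p.2 p.1| ≤ δ := by
    have : rampPath v c p.2 p.1 = (p.2 - c) * v p.2 p.1 := rfl
    rw [this, abs_mul, abs_of_nonneg hθ0]
    nlinarith [abs_nonneg (v p.2 p.1)]
  have h1 : |(p.2 - c) * D.f p.1 (v p.2 p.1)| ≤ C * δ := by
    rw [abs_mul, abs_of_nonneg hθ0]
    have := (hf p.1 (v p.2 p.1)).trans (mul_le_mul_of_nonneg_left hvx hC.le)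
    nlinarith [abs_nonneg (D.f p.1 (v p.2 p.1))]
  have h2 : |D.f p.1 (rampPath v c p.2 p.1)| ≤ C * δ :=
    (hf _ _).trans (mul_le_mul_of_nonneg_left hw hC.le)
  have h3 : |(p.2 - c) * D.σ p.1 (v p.2 p.1) * h p| ≤ M * |h p| := by
    rw [abs_mul, abs_mul, abs_of_nonneg hθ0]
    refine mul_le_mul_of_nonneg_right ?_ (abs_nonneg _)
    nlinarith [(hM p.1 (v p.2 p.1)).2, abs_nonneg (D.σ p.1 (v p.2 p.1))]
  rw [rampControl, abs_div]
  calc _ ≤ ((2 * C + 1) * δ + M * |h p|) / |D.σ p.1 (rampPath v c p.2 p.1)| := by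
        gcongr
        refine (abs_add_le _ _).trans ?_
        refine (add_le_add_left ((abs_add_le _ _).trans
          (add_le_add_left (abs_sub _ _) _)) _).trans ?_
        linarith
    _ ≤ ((2 * C + 1) * δ + M * |h p|) / m := by
        gcongr
        exact hσ _ _
    _ = _ := by ring

lemma continuousOn_rampPath {v : ℝ → C(unitInterval, ℝ)} {S : Set ℝ} (hv : ContinuousOn v S)
    (c : ℝ) : ContinuousOn (rampPath v c) S :=
  (continuousOn_id.sub continuousOn_const).smul hv

lemma memLp_rampControl {D : Data} (hF1 : F1 D) (hF2 : F2 D) (hf0 : ∀ x, D.f x 0 = 0)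
    {h : unitInterval × ℝ → ℝ} {v : ℝ → C(unitInterval, ℝ)} {c δ : ℝ}
    (hh : MemLp h 2 (volume.restrict (univ ×ˢ Icc c (c + 1))))
    (hv : ContinuousOn v (Icc c (c + 1))) (hδ : ∀ t ∈ Icc c (c + 1), ‖v t‖ ≤ δ) :
    MemLp (rampControl D h v c) 2 (volume.restrict (univ ×ˢ Icc c (c + 1))) := by
  obtain ⟨A, B, hA, hB, hAB⟩ := exists_abs_rampControl_le hF1 hF2 hf0
  have hg : MemLp (fun p => A * δ + B * |h p|) 2 (volume.restrict (univ ×ˢ Icc c (c + 1))) :=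
    MemLp.add (f := fun _ => A * δ) (memLp_const _) (hh.abs.const_mul B)
  have hm : AEStronglyMeasurable (rampControl D h v c)
      (volume.restrict (univ ×ˢ Icc c (c + 1))) := by
    have hvm := aestronglyMeasurable_eval hv
    have hwm := aestronglyMeasurable_eval (continuousOn_rampPath hv c)
    have hcomp : ∀ (F : unitInterval → ℝ → ℝ) (u : ℝ → C(unitInterval, ℝ)),
        Measurable (fun p : unitInterval × ℝ => F p.1 p.2) →
        AEStronglyMeasurable (fun p : unitInterval × ℝ => u p.2 p.1)
          (volume.restrict (univ ×ˢ Icc c (c + 1))) →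
        AEMeasurable (fun p : unitInterval × ℝ => F p.1 (u p.2 p.1))
          (volume.restrict (univ ×ˢ Icc c (c + 1))) := fun F u hF hu =>
      hF.comp_aemeasurable (measurable_fst.aemeasurable.prodMk hu.aemeasurable)
    have hθ : AEMeasurable (fun p : unitInterval × ℝ => p.2 - c)
        (volume.restrict (univ ×ˢ Icc c (c + 1))) :=
      (measurable_snd.sub_const c).aemeasurable
    have hfv := hcomp D.f v hF1.measurable_f hvm
    have hfw := hcomp D.f (rampPath v c) hF1.measurable_f hwm
    have hσv := hcomp D.σ v hF2.1.measurable hvm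
    have hσw := hcomp D.σ (rampPath v c) hF2.1.measurable hwm
    have hvm' := hvm.aemeasurable
    have hhm := hh.aestronglyMeasurable.aemeasurable
    refine AEMeasurable.aestronglyMeasurable ?_
    exact (((((hθ.mul hfv).sub hfw).add ((hθ.mul hσv).mul hhm)).add hvm')).div hσw
  have hb : ∀ᵐ p ∂((volume : Measure (unitInterval × ℝ)).restrict (univ ×ˢ Icc c (c + 1))),
      ‖rampControl D h v c p‖ ≤ A * δ + B * |h p| := by
    filter_upwards [ae_restrict_mem (MeasurableSet.univ.prod measurableSet_Icc)] with p hp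
    exact hAB h v c δ p hp.2 (hδ _ hp.2)
  exact hg.mono' hm hb

/-- As long as `v` is not reflected, the path `(t - c) v(t)` is the solution driven by
`rampControl D h v c`. -/
lemma IsSolutionWith.ramp {D : Data} (hH1 : H1 D) (hF1 : F1 D) (hF2 : F2 D)
    (hf0 : ∀ x, D.f x 0 = 0) {h : unitInterval × ℝ → ℝ} {v : ℝ → C(unitInterval, ℝ)}
    {η ξ : Measure (unitInterval × ℝ)} {c δ : ℝ}
    (H : IsSolutionWith D (Icc c (c + 1)) h v η ξ) (hδ : ∀ t ∈ Icc c (c + 1), ‖v t‖ ≤ δ)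
    (hη : η (univ ×ˢ Icc c (c + 1)) = 0) (hξ : ξ (univ ×ˢ Icc c (c + 1)) = 0) :
    IsSolutionWith D (Icc c (c + 1)) (rampControl D h v c) (rampPath v c) 0 0 where
  control s hs t ht := by
    have hc : c ∈ Icc c (c + 1) := ⟨le_rfl, by linarith⟩
    have hc1 : c + 1 ∈ Icc c (c + 1) := ⟨by linarith, le_rfl⟩
    exact (memLp_rampControl hF1 hF2 hf0 (H.control _ hc _ hc1) H.continuousOn hδ).mono_measure
      (Measure.restrict_mono (prod_mono subset_rfl (Icc_subset_Icc hs.1 ht.2)) le_rfl)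
  continuousOn := continuousOn_rampPath H.continuousOn c
  mem_E t ht x := by
    have h1 := H.mem_E t ht x
    have h2 := hH1 x
    have h3 : 0 ≤ t - c := sub_nonneg.2 ht.1
    have h4 : t - c ≤ 1 := by linarith [ht.2]
    have : rampPath v c t x = (t - c) * v t x := rfl
    rw [this]
    constructor <;> nlinarith
  finite_η s _ t _ := by simp
  finite_ξ s _ t _ := by simp
  reflect_η := by simp
  reflect_ξ := by simp
  weak φ hφ s hs t ht hst := by
    have hsub : Icc s t ⊆ Icc c (c + 1) := Icc_subset_Icc hs.1 ht.2
    have hnull : ∀ {μ : Measure (unitInterval × ℝ)}, μ (univ ×ˢ Icc c (c + 1)) = 0 →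
        ∀ r ∈ Icc s t, μ.restrict (univ ×ˢ Ioc s r) = 0 := fun hμ r hr =>
      Measure.restrict_eq_zero.2 (measure_mono_null (prod_mono subset_rfl
        ((Ioc_subset_Icc_self.trans (Icc_subset_Icc_right hr.2)).trans hsub)) hμ)
    have hg : IntegrableOn (weakIntegrand D h v φ) (univ ×ˢ Ioc s t) :=
      (integrableOn_weakIntegrand hF1 hF2 (H.control s hs t ht) (H.continuousOn.mono hsub)
        (fun r hr => H.mem_E r (hsub hr)) hφ).mono_set (prod_mono subset_rfl Ioc_subset_Icc_self)
    have hvφ : IntegrableOn (fun p : unitInterval × ℝ => v p.2 p.1 * φ p.1) (univ ×ˢ Ioc s t) :=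
      (integrableOn_eval_mul (H.continuousOn.mono hsub) (fun r hr => H.mem_E r (hsub hr))
        hφ.continuous).mono_set (prod_mono subset_rfl Ioc_subset_Icc_self)
    have hθg : IntegrableOn (fun p => (p.2 - c) * weakIntegrand D h v φ p) (univ ×ˢ Ioc s t) := by
      refine Integrable.bdd_mul (c := 1) hg (Continuous.aestronglyMeasurable (by fun_prop)) ?_
      filter_upwards [ae_restrict_mem (MeasurableSet.univ.prod measurableSet_Ioc)] with p hp
      have := hsub (Ioc_subset_Icc_self hp.2)
      rw [Real.norm_eq_abs, abs_le]
      constructor <;> linarith [this.1, this.2]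
    set a : ℝ → ℝ := fun r => ∫ x : unitInterval, v r x * φ x with ha
    set G : ℝ → ℝ := fun r => ∫ x : unitInterval, weakIntegrand D h v φ (x, r) with hG
    have hGi : IntervalIntegrable G volume s t := by
      rw [intervalIntegrable_iff_integrableOn_Ioc_of_le hst]
      have := hg
      rw [IntegrableOn, volume_restrict_univ_prod] at this
      exact this.integral_prod_right
    have haG : ∀ r ∈ Icc s t, a r = a s + ∫ u in s..r, G u := by
      intro r hr
      have hw := H.weak φ hφ s hs r (hsub hr) hr.1
      rw [hnull hη r hr, hnull hξ r hr, integral_zero_measure,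
        add_zero, sub_zero] at hw
      rw [intervalIntegral.integral_of_le hr.1, hG, ← setIntegral_univ_prod
        (hg.mono_set (prod_mono subset_rfl (Ioc_subset_Ioc_right hr.2)))]
      simp only [ha, weakIntegrand]
      linarith
    have hmain := integral_linear_weight (c := c) hst hGi haG
    -- The control is chosen so that this pointwise identity holds.
    have hpt : ∀ p : unitInterval × ℝ, weakIntegrand D (rampControl D h v c) (rampPath v c) φ p =
        (p.2 - c) * weakIntegrand D h v φ p + v p.2 p.1 * φ p.1 := by
      intro p
      obtain ⟨-, m, hm, hσ⟩ := hF2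
      have hne : D.σ p.1 (rampPath v c p.2 p.1) ≠ 0 := abs_pos.1 (hm.trans_le (hσ _ _))
      have hu : D.σ p.1 (rampPath v c p.2 p.1) * rampControl D h v c p =
          (p.2 - c) * D.f p.1 (v p.2 p.1) - D.f p.1 (rampPath v c p.2 p.1)
            + (p.2 - c) * D.σ p.1 (v p.2 p.1) * h p + v p.2 p.1 := by
        rw [rampControl, mul_div_cancel₀ _ hne]
      have hw : rampPath v c p.2 p.1 = (p.2 - c) * v p.2 p.1 := rfl
      rw [weakIntegrand, hu, weakIntegrand, hw]
      ring
    have hend : ∀ r, ∫ x : unitInterval, rampPath v c r x * φ x = (r - c) * a r := by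
      intro r
      rw [ha, ← integral_const_mul]
      congr 1 with x
      exact mul_assoc _ _ _
    have hrhs : ∫ p in (univ : Set unitInterval) ×ˢ Ioc s t,
        weakIntegrand D (rampControl D h v c) (rampPath v c) φ p =
        ∫ r in s..t, ((r - c) * G r + a r) := by
      simp only [hpt]
      rw [setIntegral_univ_prod (F := fun p => (p.2 - c) * weakIntegrand D h v φ p
        + v p.2 p.1 * φ p.1) (hθg.add hvφ), intervalIntegral.integral_of_le hst]
      have hsec := hg
      rw [IntegrableOn, volume_restrict_univ_prod] at hsec
      have hsec' := hvφ
      rw [IntegrableOn, volume_restrict_univ_prod] at hsec'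
      refine integral_congr_ae ?_
      filter_upwards [hsec.prod_left_ae, hsec'.prod_left_ae] with r h1 h2
      simp only [hG, ha]
      rw [integral_add (h1.const_mul _) h2, integral_const_mul]
    rw [hend, hend, hmain, ← hrhs]
    simp [weakIntegrand]

lemma energy_rampControl_le {D : Data} {A B : ℝ} {h : unitInterval × ℝ → ℝ}
    {v : ℝ → C(unitInterval, ℝ)} {c δ : ℝ}
    (hAB : ∀ p : unitInterval × ℝ, p.2 ∈ Icc c (c + 1) →
      |rampControl D h v c p| ≤ A * δ + B * |h p|) :
    energy (Icc c (c + 1)) (rampControl D h v c) ≤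
      ENNReal.ofReal ((A * δ) ^ 2) + ENNReal.ofReal (2 * B ^ 2) * energy (Icc c (c + 1)) h := by
  have hvol : (volume : Measure (unitInterval × ℝ)) (univ ×ˢ Icc c (c + 1)) = 1 := by
    rw [Measure.volume_eq_prod, Measure.prod_prod]
    simp
  have hint : ∫⁻ p in (univ : Set unitInterval) ×ˢ Icc c (c + 1),
      ENNReal.ofReal (rampControl D h v c p ^ 2) ≤
      ENNReal.ofReal (2 * (A * δ) ^ 2) + ENNReal.ofReal (2 * B ^ 2) *
        ∫⁻ p in (univ : Set unitInterval) ×ˢ Icc c (c + 1), ENNReal.ofReal (h p ^ 2) := by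
    calc _ ≤ ∫⁻ p in (univ : Set unitInterval) ×ˢ Icc c (c + 1),
          (ENNReal.ofReal (2 * (A * δ) ^ 2) +
            ENNReal.ofReal (2 * B ^ 2) * ENNReal.ofReal (h p ^ 2)) := by
          refine setLIntegral_mono' (MeasurableSet.univ.prod measurableSet_Icc) fun p hp => ?_
          rw [← ENNReal.ofReal_mul (by positivity), ← ENNReal.ofReal_add (by positivity)
            (by positivity)]
          refine ENNReal.ofReal_le_ofReal ?_
          have h1 := hAB p hp.2
          rw [← sq_abs (rampControl D h v c p), ← sq_abs (h p)]
          have h2 := pow_le_pow_left₀ (abs_nonneg _) h1 2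
          nlinarith [sq_nonneg (A * δ - B * |h p|)]
      _ = _ := by
          rw [lintegral_add_left measurable_const, lintegral_const_mul' _ _ ENNReal.ofReal_ne_top,
            setLIntegral_const, hvol, mul_one]
  unfold energy
  calc _ ≤ 2⁻¹ * (ENNReal.ofReal (2 * (A * δ) ^ 2) + ENNReal.ofReal (2 * B ^ 2) *
        ∫⁻ p in (univ : Set unitInterval) ×ˢ Icc c (c + 1), ENNReal.ofReal (h p ^ 2)) := by
        gcongr
    _ = _ := by
        rw [mul_add, ENNReal.ofReal_mul zero_le_two, ← mul_assoc, ENNReal.ofReal_ofNat,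
          ENNReal.inv_mul_cancel two_ne_zero ENNReal.ofNat_ne_top, one_mul, mul_left_comm]

/-! ### The tails of a path of finite action -/

/-- A reflection measure does not charge the times at which the path keeps a positive distance
from the wall. -/
lemma measure_eq_zero_of_gap {μ : Measure (unitInterval × ℝ)} {T S : Set ℝ} (hST : S ⊆ T)
    (hS : MeasurableSet S) {F : unitInterval × ℝ → ℝ} {κ : ℝ} (hκ : 0 < κ)
    (hF : ∀ p : unitInterval × ℝ, p.2 ∈ S → κ ≤ F p)
    (h0 : ∫⁻ p in univ ×ˢ T, ENNReal.ofReal (F p) ∂μ = 0) : μ (univ ×ˢ S) = 0 := by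
  have h1 : ENNReal.ofReal κ * μ (univ ×ˢ S) ≤ 0 := by
    rw [← setLIntegral_const, ← h0]
    exact (setLIntegral_mono' (MeasurableSet.univ.prod hS) fun p hp =>
      ENNReal.ofReal_le_ofReal (hF p hp.2)).trans (lintegral_mono_set (prod_mono subset_rfl hST))
  have h2 : ENNReal.ofReal κ ≠ 0 := by simpa using hκ
  exact (mul_eq_zero.1 (le_antisymm h1 zero_le)).resolve_left h2

lemma H1.exists_gap {D : Data} (hH1 : H1 D) :
    ∃ κ, 0 < κ ∧ ∀ x, D.K₁ x ≤ -κ ∧ κ ≤ D.K₂ x := by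
  have hc : Continuous fun x => min (-D.K₁ x) (D.K₂ x) := by fun_prop
  obtain ⟨x₀, -, hx₀⟩ := isCompact_univ.exists_isMinOn univ_nonempty hc.continuousOn
  refine ⟨_, lt_min (neg_pos.2 (hH1 x₀).1) (hH1 x₀).2, fun x => ?_⟩
  have h := le_min_iff.1 (isMinOn_iff.1 hx₀ x (mem_univ x))
  exact ⟨le_neg.1 h.1, h.2⟩

lemma energy_mono {T T' : Set ℝ} (hT : T ⊆ T') (h : unitInterval × ℝ → ℝ) :
    energy T h ≤ energy T' h := by
  unfold energy
  gcongr

lemma tendsto_energy_atBot {h : unitInterval × ℝ → ℝ} (hh : energy (Iic 0) h ≠ ⊤) :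
    Tendsto (fun c => energy (Iic c) h) atBot (𝓝 0) := by
  set μ := (volume : Measure (unitInterval × ℝ)).withDensity fun p => ENNReal.ofReal (h p ^ 2)
    with hμ
  have hen : ∀ c : ℝ, energy (Iic c) h = 2⁻¹ * μ (univ ×ˢ Iic c) := fun c => by
    rw [energy, hμ, withDensity_apply _ (MeasurableSet.univ.prod measurableSet_Iic)]
  have h0 : μ (univ ×ˢ Iic (0 : ℝ)) ≠ ⊤ := fun h => hh (by
    rw [hen, h]
    exact ENNReal.mul_top (by simp))
  have hinter : ⋂ c : ℝ, (univ : Set unitInterval) ×ˢ Iic c = ∅ := by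
    refine eq_empty_of_forall_notMem fun p hp => ?_
    have := (mem_iInter.1 hp (p.2 - 1)).2
    simp only [mem_Iic] at this
    linarith
  have ht : Tendsto (fun c : ℝ => μ (univ ×ˢ Iic c)) atBot (𝓝 0) := by
    have := tendsto_measure_iInter_atBot (μ := μ)
      (s := fun c : ℝ => (univ : Set unitInterval) ×ˢ Iic c)
      (fun c => (MeasurableSet.univ.prod measurableSet_Iic).nullMeasurableSet)
      (fun c d hcd => prod_mono subset_rfl (Iic_subset_Iic.2 hcd)) ⟨0, h0⟩
    rwa [hinter, measure_empty] at this
  simp only [hen]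
  simpa using ENNReal.Tendsto.const_mul ht (Or.inr (by simp : (2⁻¹ : ℝ≥0∞) ≠ ⊤))

/-! ### The two inequalities -/

section
variable {D : Data}

lemma action_le_energy {T : Set ℝ} {h : unitInterval × ℝ → ℝ} {v : ℝ → C(unitInterval, ℝ)}
    (H : IsSolution D T h v) : action D T v ≤ energy T h :=
  iInf₂_le h H

lemma J_le_energy {t : ℝ} (ht : 0 < t) {h : unitInterval × ℝ → ℝ} {v : ℝ → C(unitInterval, ℝ)}
    (H : IsSolution D (Icc 0 t) h v) (h0 : v 0 = 0) : J D (v t) ≤ energy (Icc 0 t) h := by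
  have hv : ContinuousOn v (Icc 0 t) ∧ ∀ s ∈ Icc 0 t, v s ∈ E D := by
    obtain ⟨_, _, A⟩ := H
    exact ⟨A.continuousOn, A.mem_E⟩
  exact (iInf₂_le t ht).trans ((iInf₂_le v ⟨hv.1, hv.2, h0, rfl⟩).trans (action_le_energy H))

/-- A path from `0` to `z` in finite time is preceded by the zero path. -/
lemma iInf_action_le_J (hH1 : H1 D) (hF1 : F1 D) (hF2 : F2 D) (hf0 : ∀ x, D.f x 0 = 0)
    (z : C(unitInterval, ℝ)) :
    (⨅ (v : ℝ → C(unitInterval, ℝ))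
      (_ : ContinuousOn v (Iic 0) ∧ v 0 = z ∧ Tendsto v atBot (𝓝 0)), action D (Iic 0) v) ≤
      J D z := by
  refine le_iInf₂ fun t ht => le_iInf₂ fun v hv => le_iInf₂ fun h ⟨η, ξ, H⟩ => ?_
  obtain ⟨-, -, hv0, hvt⟩ := hv
  have hpre : (· + t) ⁻¹' Icc 0 t = Icc (-t) 0 := by simp
  have H' := H.shift t
  rw [hpre] at H'
  have hconc := IsSolution.concat (b := -t) hF1 hF2 ordConnected_Iic subset_rfl self_mem_Iic
    ordConnected_Icc (fun r hr => hr.1) (left_mem_Icc.2 (by linarith))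
    ⟨0, 0, isSolutionWith_zero hH1 hf0 (Iic (-t))⟩ ⟨_, _, H'⟩ (by simp [hv0])
  have hun : Iic (-t) ∪ Icc (-t) 0 = Iic 0 := Iic_union_Icc_eq_Iic (by linarith)
  rw [hun] at hconc
  have hcont : ContinuousOn (fun r => if r ≤ -t then (0 : ℝ → C(unitInterval, ℝ)) r
      else v (r + t)) (Iic 0) := by
    obtain ⟨_, _, A⟩ := hconc
    exact A.continuousOn
  refine (iInf₂_le _ ⟨hcont, ?_, ?_⟩).trans ((action_le_energy hconc).trans ?_)
  · rw [← hun]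
    refine (energy_concat_le measurableSet_Iic measurableSet_Icc subset_rfl
      (fun r hr => hr.1) _ _).trans ?_
    rw [← hpre, energy_shift]
    simp [energy]
  · have : ¬ (0 : ℝ) ≤ -t := by linarith
    simp [this, hvt]
  · refine tendsto_const_nhds.congr' ?_
    filter_upwards [Iic_mem_atBot (-t)] with r hr
    exact (if_pos hr).symm

/-- The values of a path which is small near `-∞` are reached from `0` at small cost, by switching
the path on linearly during a unit of time in the remote past. -/
lemma J_le_iInf_action (hH1 : H1 D) (hF1 : F1 D) (hF2 : F2 D) (hf0 : ∀ x, D.f x 0 = 0)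
    (z : C(unitInterval, ℝ)) :
    J D z ≤ ⨅ (v : ℝ → C(unitInterval, ℝ))
      (_ : ContinuousOn v (Iic 0) ∧ v 0 = z ∧ Tendsto v atBot (𝓝 0)), action D (Iic 0) v := by
  refine le_iInf₂ fun v ⟨_, hv0, hvlim⟩ => le_iInf₂ fun h ⟨η, ξ, H⟩ => ?_
  rcases eq_or_ne (energy (Iic 0) h) ⊤ with htop | htop
  · exact htop ▸ le_top
  obtain ⟨A, B, -, -, hAB⟩ := exists_abs_rampControl_le hF1 hF2 hf0
  obtain ⟨κ, hκ, hgap⟩ := hH1.exists_gap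
  refine ENNReal.le_of_forall_pos_le_add fun ε hε _ => ?_
  have hε2 : (0 : ℝ≥0∞) < ε / 2 := ENNReal.half_pos (by exact_mod_cast hε.ne')
  obtain ⟨δ, hδε, hδ0, hδκ⟩ : ∃ δ : ℝ, ENNReal.ofReal ((A * δ) ^ 2) < ε / 2 ∧ 0 < δ ∧ δ < κ := by
    have h1 : Tendsto (fun δ : ℝ => ENNReal.ofReal ((A * δ) ^ 2)) (𝓝[>] 0) (𝓝 0) :=
      ((ENNReal.continuous_ofReal.comp (by fun_prop : Continuous fun δ : ℝ => (A * δ) ^ 2)).tendsto'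
        0 0 (by simp)).mono_left nhdsWithin_le_nhds
    exact ((h1.eventually_lt_const hε2).and (Ioo_mem_nhdsGT hκ)).exists
  have hsmall : ∀ᶠ t in atBot, ‖v t‖ ≤ δ := by
    have h0 : ‖(0 : C(unitInterval, ℝ))‖ < δ := by simpa using hδ0
    filter_upwards [hvlim.norm.eventually_lt_const h0] with t ht using ht.le
  have hcost : Tendsto (fun b => ENNReal.ofReal (2 * B ^ 2) * energy (Iic b) h) atBot (𝓝 0) := by
    have := ENNReal.Tendsto.const_mul (tendsto_energy_atBot htop)
      (Or.inr (ENNReal.ofReal_ne_top (r := 2 * B ^ 2)))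
    rwa [mul_zero] at this
  -- Below, the path is switched on during `[c, c + 1]`.
  obtain ⟨c, hvδ, hcε, hc⟩ : ∃ c : ℝ, (∀ t ≤ c + 1, ‖v t‖ ≤ δ) ∧
      ENNReal.ofReal (2 * B ^ 2) * energy (Iic (c + 1)) h < ε / 2 ∧ c + 1 < 0 := by
    obtain ⟨b, h1, h2, h3⟩ := ((eventually_forall_le_atBot.2 hsmall).and
      ((hcost.eventually_lt_const hε2).and (eventually_lt_atBot 0))).exists
    exact ⟨b - 1, by simpa using h1, by simpa using h2, by simpa using h3⟩
  have hcc : c ≤ c + 1 := by linarith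
  have hsub : Icc c (c + 1) ⊆ Iic 0 := fun t ht => ht.2.trans hc.le
  have hvx : ∀ p : unitInterval × ℝ, p.2 ∈ Icc c (c + 1) → |v p.2 p.1| ≤ δ := fun p hp =>
    ((v p.2).norm_coe_le_norm p.1).trans (hvδ _ hp.2)
  have hη : η (univ ×ˢ Icc c (c + 1)) = 0 :=
    measure_eq_zero_of_gap hsub measurableSet_Icc (sub_pos.2 hδκ)
      (fun p hp => by linarith [(hgap p.1).1, (abs_le.1 (hvx p hp)).1]) H.reflect_η
  have hξ : ξ (univ ×ˢ Icc c (c + 1)) = 0 :=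
    measure_eq_zero_of_gap hsub measurableSet_Icc (sub_pos.2 hδκ)
      (fun p hp => by linarith [(hgap p.1).2, (abs_le.1 (hvx p hp)).2]) H.reflect_ξ
  have hramp := (H.mono hsub).ramp hH1 hF1 hF2 hf0 (fun t ht => hvδ t ht.2) hη hξ
  have hconc := IsSolution.concat (b := c + 1) hF1 hF2 ordConnected_Icc (fun r hr => hr.2)
    (right_mem_Icc.2 hcc) ordConnected_Icc (fun r hr => hr.1) (left_mem_Icc.2 hc.le)
    ⟨_, _, hramp⟩ ⟨_, _, H.mono (Icc_subset_Iic_self : Icc (c + 1) 0 ⊆ Iic 0)⟩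
    (by simp [rampPath])
  have hun : Icc c (c + 1) ∪ Icc (c + 1) 0 = Icc c 0 := Icc_union_Icc_eq_Icc hcc hc.le
  have hpre : (· + c) ⁻¹' (Icc c (c + 1) ∪ Icc (c + 1) 0) = Icc 0 (-c) := by
    rw [hun]
    simp
  have hramp0 : rampPath v c c = 0 := by rw [rampPath, sub_self, zero_smul]
  obtain ⟨η', ξ', H'⟩ := hconc
  have Hs := H'.shift c
  rw [hpre] at Hs
  have hJ := J_le_energy (by linarith : 0 < -c) ⟨_, _, Hs⟩ (by simp [hramp0])
  have hend : ¬ (0 : ℝ) ≤ c + 1 := not_le.2 hc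
  simp only [neg_add_cancel, hend, if_false, hv0] at hJ
  refine hJ.trans ?_
  rw [← hpre, energy_shift]
  refine (energy_concat_le measurableSet_Icc measurableSet_Icc (fun r hr => hr.2)
    (fun r hr => hr.1) _ _).trans ?_
  have h1 := energy_rampControl_le (h := h) (v := v) (c := c) (δ := δ) (A := A) (B := B)
    fun p hp => hAB h v c δ p hp (hvδ _ hp.2)
  have h2 : ENNReal.ofReal (2 * B ^ 2) * energy (Icc c (c + 1)) h ≤ ε / 2 :=
    (by gcongr; exact energy_mono Icc_subset_Iic_self h :
      _ ≤ ENNReal.ofReal (2 * B ^ 2) * energy (Iic (c + 1)) h).trans hcε.le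
  have h3 : energy (Icc (c + 1) 0) h ≤ energy (Iic 0) h := energy_mono Icc_subset_Iic_self h
  calc _ ≤ (ε / 2 + ε / 2) + energy (Iic 0) h :=
        add_le_add (h1.trans (add_le_add hδε.le h2)) h3
    _ = _ := by rw [ENNReal.add_halves, add_comm]

end

end ReflectedSkeleton

theorem theorem4p2 (D : ReflectedSkeleton.Data)
    (hH1 : ReflectedSkeleton.H1 D) (hH2 : ReflectedSkeleton.H2 D)
    (hF1 : ReflectedSkeleton.F1 D) (hF2 : ReflectedSkeleton.F2 D)
    (hf0 : ∀ x, D.f x 0 = 0)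
    (z : C(unitInterval, ℝ)) (hz : z ∈ ReflectedSkeleton.E D) :
    ReflectedSkeleton.J D z =
      ⨅ (v : ℝ → C(unitInterval, ℝ))
        (_ : ContinuousOn v (Set.Iic 0) ∧ v 0 = z ∧ Filter.Tendsto v Filter.atBot (nhds 0)),
        ReflectedSkeleton.action D (Set.Iic 0) v :=
  le_antisymm (ReflectedSkeleton.J_le_iInf_action hH1 hF1 hF2 hf0 z)
    (ReflectedSkeleton.iInf_action_le_J hH1 hF1 hF2 hf0 z)
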